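/- All systems are finite-dimensional and non-zero. Let $n\ge 0$ and let $\alpha=(\alpha_{s,t})$ be real coefficients indexed by pairs $s\subseteq\{B,E\}$, $t\subseteq\{V_1,\dots,V_n\}$. For a channel $\mathcal N$ with isometric extension $U_{\mathcal N}:A\to BE$ and a state $\phi_{V_1\dots V_nA}$ put $$f_\alpha(U_{\mathcal N},\phi)=\sum_{s\subseteq\{B,E\}}\ \sum_{t\subseteq\{V_1,\dots,V_n\}}\alpha_{s,t}\,H(\rho_{st}),\qquad \rho_{V_1\dots V_nBE}=(I\otimes U_{\mathcal N})\,\phi\,(I\otimes U_{\mathcal N}^\dagger),$$ where $\rho_{st}$ is the reduced state of $\rho$ on the systems in $s\cup t$ and $H(\sigma)=-\mathrm{tr}\,\sigma\log\sigma$ (the base of the logarithm is immaterial), and let $f_\alpha(U_{\mathcal N})=\sup_{\phi}f_\alpha(U_{\mathcal N},\phi)\in[-\infty,\infty]$, the supremum being over all $V_1,\dots,V_n$ of arbitrary finite dimension and all states $\phi_{V_1\dots V_nA}$. A standard decoupling $D$ assigns each of $B_2,E_2$ either to one index $i\in\{1,\dots,n\}$ or to none, and likewise each of $B_1,E_1$.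 Given isometric extensions $U_1:A_1\to B_1E_1$, $U_2:A_2\to B_2E_2$ of two channels and a state $\phi_{V_1\dots V_nA_1A_2}$, it produces two states. The state $\tilde\phi_{\tilde V_1\dots\tilde V_nA_1}$ is obtained by applying $U_2$ to $A_2$, letting $\tilde V_i$ consist of $V_i$ and those of $B_2,E_2$ that are assigned to $i$, and tracing out those that are assigned to no index. The state $\hat\phi_{\hat V_1\dots\hat V_nA_2}$ is obtained in the same way by applying $U_1$ to $A_1$ and using the assignment of $B_1,E_1$. The formula $f_\alpha$ is uniformly subadditive with respect to $D$ if, for all $U_1$, $U_2$ and $\phi_{V_1\dots V_nA_1A_2}$, $$f_\alpha(U_1\otimes U_2,\phi)\le f_\alpha(U_1,\tilde\phi)+f_\alpha(U_2,\hat\phi),$$ where $U_1\otimes U_2$ has input $A_1A_2$ and outputs $B=B_1B_2$, $E=E_1E_2$. **Lemma.** Suppose that $f_\alpha(U_{\mathcal N})<\infty$ for some $U_{\mathcal N}$ and that $f_\alpha$ is uniformly subadditive with respect to some standard decoupling. Then for every non-empty $t\subseteq\{V_1,\dots,V_n\}$, $$\eta_t:=\sum_{s\subseteq\{B,E\}}\alpha_{s,t}=0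 .$$ -/

import Mathlib

open scoped Kronecker Matrix ComplexOrder

noncomputable section

namespace EntropicFormula

/-- A quantum state of a finite-dimensional system whose Hilbert space has an orthonormal basis
indexed by `Ω`: a positive semidefinite matrix of trace one. -/
@[ext] structure State (Ω : Type) [Fintype Ω] where
  mat : Matrix Ω Ω ℂ
  posSemidef : mat.PosSemidef
  trace_eq_one : mat.trace = 1

namespace State

variable {Ω Ω' K R : Type} [Fintype Ω] [Fintype Ω'] [Fintype K] [Fintype R]

/-- The von Neumann entropy `H(ρ) = -tr (ρ log ρ)`, computed from the eigenvalues of `ρ`. -/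
def entropy [DecidableEq Ω] (ρ : State Ω) : ℝ :=
  ∑ i, Real.negMulLog (ρ.posSemidef.isHermitian.eigenvalues i)

/-- The state `W ρ W†` obtained by applying an isometry `W`. -/
def conj [DecidableEq Ω] (W : Matrix Ω' Ω ℂ) (hW : Wᴴ * W = 1) (ρ : State Ω) : State Ω' where
  mat := W * ρ.mat * Wᴴ
  posSemidef := ρ.posSemidef.mul_mul_conjTranspose_same W
  trace_eq_one := by
    rw [Matrix.trace_mul_comm, ← Matrix.mul_assoc, hW, Matrix.one_mul, ρ.trace_eq_one]

/-- The same state with its basis relabelled along `e`. -/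
def relabel (e : Ω ≃ Ω') (ρ : State Ω) : State Ω' where
  mat := ρ.mat.submatrix e.symm e.symm
  posSemidef := ρ.posSemidef.submatrix _
  trace_eq_one := by
    rw [← ρ.trace_eq_one]
    exact Equiv.sum_comp e.symm (fun x => ρ.mat x x)

/-- The reduced state on the kept system `K`, with the remaining system `R` traced out. -/
def partialTrace (ρ : State (K × R)) : State K where
  mat := Matrix.of fun x y => ∑ r, ρ.mat (x, r) (y, r)
  posSemidef := by
    have h : (Matrix.of fun x y => ∑ r, ρ.mat (x, r) (y, r) : Matrix K K ℂ)
        = ∑ r, ρ.mat.submatrix (fun x => (x, r)) (fun x => (x, r)) := by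
      ext x y
      simp [Matrix.sum_apply]
    rw [h]
    exact Matrix.posSemidef_sum _ fun r _ => ρ.posSemidef.submatrix _
  trace_eq_one := by
    rw [← ρ.trace_eq_one]
    simp [Matrix.trace, Fintype.sum_prod_type]

end State

/-- The two output systems of a channel: the receiver's output `B` and the environment `E`. -/
inductive Output : Type
  | B
  | E
  deriving DecidableEq

instance : Fintype Output := ⟨{Output.B, Output.E}, fun o => by cases o <;> simp⟩

/-- A quantum channel, given by its isometric extension `U : A → B E`.  The input has basis `A`;
the outputs `B` and `E` have bases `O Output.B` and `O Output.E`, so that `B E` has the product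
basis `∀ o, O o`. -/
structure Channel (A : Type) [Fintype A] [DecidableEq A]
    (O : Output → Type) [∀ o, Fintype (O o)] where
  U : Matrix (∀ o, O o) A ℂ
  isometry : Uᴴ * U = 1

/-- The isometry `U₁ ⊗ U₂` of two parallel channels: its input is `A₁ A₂`, its outputs are
`B₁ B₂` and `E₁ E₂`. -/
def Channel.tensor {A₁ A₂ : Type} [Fintype A₁] [DecidableEq A₁] [Fintype A₂] [DecidableEq A₂]
    {O₁ O₂ : Output → Type} [∀ o, Fintype (O₁ o)] [∀ o, Fintype (O₂ o)]
    (N₁ : Channel A₁ O₁) (N₂ : Channel A₂ O₂) :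
    Channel (A₁ × A₂) (fun o => O₁ o × O₂ o) where
  U := (N₁.U ⊗ₖ N₂.U).submatrix (fun y => (fun o => (y o).1, fun o => (y o).2)) id
  isometry := by
    let e : (∀ o, O₁ o × O₂ o) ≃ (∀ o, O₁ o) × (∀ o, O₂ o) :=
      ⟨fun y => (fun o => (y o).1, fun o => (y o).2), fun p o => (p.1 o, p.2 o),
        fun _ => rfl, fun _ => rfl⟩
    have h : ((N₁.U ⊗ₖ N₂.U).submatrix e (Equiv.refl _))ᴴ *
        (N₁.U ⊗ₖ N₂.U).submatrix e (Equiv.refl _) = 1 := by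
      rw [Matrix.conjTranspose_submatrix, Matrix.submatrix_mul_equiv,
        Matrix.conjTranspose_kronecker, ← Matrix.mul_kronecker_mul, N₁.isometry, N₂.isometry,
        Matrix.one_kronecker_one, Matrix.submatrix_one_equiv]
    exact h

/-- If `U` is an isometry, so is `I ⊗ U`. -/
theorem one_kronecker_isometry {X Y Z : Type} [Fintype X] [DecidableEq X] [Fintype Y]
    [DecidableEq Y] [Fintype Z] {U : Matrix Z Y ℂ} (hU : Uᴴ * U = 1) :
    ((1 : Matrix X X ℂ) ⊗ₖ U)ᴴ * ((1 : Matrix X X ℂ) ⊗ₖ U) = 1 := by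
  rw [Matrix.conjTranspose_kronecker, ← Matrix.mul_kronecker_mul, hU, Matrix.conjTranspose_one,
    Matrix.one_mul, Matrix.one_kronecker_one]

section OneChannel

variable {n : ℕ} {V : Fin n → Type} [∀ i, Fintype (V i)] [∀ i, DecidableEq (V i)]
  {A : Type} [Fintype A] [DecidableEq A]
  {O : Output → Type} [∀ o, Fintype (O o)] [∀ o, DecidableEq (O o)]

/-- The output state `ρ_{V₁…Vₙ B E} = (I ⊗ U) φ_{V₁…Vₙ A} (I ⊗ U†)`. -/
def outputState (N : Channel A O) (φ : State ((∀ i, V i) × A)) :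
    State ((∀ i, V i) × (∀ o, O o)) :=
  φ.conj ((1 : Matrix (∀ i, V i) (∀ i, V i) ℂ) ⊗ₖ N.U) (one_kronecker_isometry N.isometry)

/-- Splits the systems `V₁ … Vₙ B E` into the collection `s ⊆ {B, E}`, `t ⊆ {V₁, …, Vₙ}` and
the remaining systems. -/
def splitEquiv (s : Finset Output) (t : Finset (Fin n)) :
    ((∀ i, V i) × (∀ o, O o)) ≃
      ((∀ i : {i // i ∈ t}, V i) × (∀ o : {o // o ∈ s}, O o)) ×
        ((∀ i : {i // i ∉ t}, V i) × (∀ o : {o // o ∉ s}, O o)) :=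
  (Equiv.prodCongr (Equiv.piEquivPiSubtypeProd (· ∈ t) V)
    (Equiv.piEquivPiSubtypeProd (· ∈ s) O)).trans (Equiv.prodProdProdComm _ _ _ _)

/-- The entropy `H(s t)` of the reduced state of `ρ_{V₁…Vₙ B E}` on the collection `s ∪ t`,
where `s ⊆ {B, E}` and `t ⊆ {V₁, …, Vₙ}`. -/
def entropyOf (ρ : State ((∀ i, V i) × (∀ o, O o))) (s : Finset Output) (t : Finset (Fin n)) :
    ℝ :=
  ((ρ.relabel (splitEquiv s t)).partialTrace).entropy

/-- The linear entropic quantity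
`f_α(U, φ) = ∑_{s ⊆ {B,E}} ∑_{t ⊆ {V₁,…,Vₙ}} α_{s,t} H(s t)` in the output state. -/
def formula (α : Finset Output → Finset (Fin n) → ℝ) (N : Channel A O)
    (φ : State ((∀ i, V i) × A)) : ℝ :=
  ∑ s : Finset Output, ∑ t : Finset (Fin n), α s t * entropyOf (outputState N φ) s t

end OneChannel

/-- The entropic formula `f_α(U) = sup_φ f_α(U, φ)`, an extended real number.  The supremum is
over all finite-dimensional auxiliary systems `V₁, …, Vₙ` and all states `φ_{V₁…Vₙ A}`. -/
def maxFormula {n : ℕ} (α : Finset Output → Finset (Fin n) → ℝ)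
    {A : Type} [Fintype A] [DecidableEq A]
    {O : Output → Type} [∀ o, Fintype (O o)] [∀ o, DecidableEq (O o)] (N : Channel A O) : EReal :=
  ⨆ (V : Fin n → Type) (_ : ∀ i, Fintype (V i)) (_ : ∀ i, DecidableEq (V i))
    (φ : State ((∀ i, V i) × A)), ((formula α N φ : ℝ) : EReal)

/-- A standard decoupling.  In the `~` branch each of the outputs `B₂`, `E₂` of the second
channel is either added to one auxiliary system (`some i`: it becomes part of `Ṽᵢ`) or traced
out (`none`); the `^` branch does the same with the outputs `B₁`, `E₁` of the first channel. -/
structure StandardDecoupling (n : ℕ) where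
  tilde : Output → Option (Fin n)
  hat : Output → Option (Fin n)

/-- The auxiliary system `Ṽᵢ`: the system `Vᵢ` with the outputs assigned to it. -/
abbrev NewAux {n : ℕ} (m : Output → Option (Fin n)) (V : Fin n → Type) (O : Output → Type)
    (i : Fin n) : Type :=
  V i × (∀ o : {o // m o = some i}, O o)

section Decoupling

variable {n : ℕ} {V : Fin n → Type} [∀ i, Fintype (V i)] [∀ i, DecidableEq (V i)]
  {A A' : Type} [Fintype A] [DecidableEq A] [Fintype A'] [DecidableEq A']
  {O : Output → Type} [∀ o, Fintype (O o)] [∀ o, DecidableEq (O o)]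

/-- Regroups the systems `V₁ … Vₙ A B' E'` into `Ṽ₁ … Ṽₙ A` and the outputs that are assigned to
no auxiliary system. -/
def regroupEquiv (m : Output → Option (Fin n)) (V : Fin n → Type) (A : Type)
    (O : Output → Type) :
    ((∀ i, V i) × (A × (∀ o, O o))) ≃
      ((∀ i, NewAux m V O i) × A) × (∀ o : {o // m o = none}, O o) where
  toFun p := ((fun i => (p.1 i, fun o => p.2.2 o.1), p.2.1), fun o => p.2.2 o.1)
  invFun q := (fun i => (q.1.1 i).1, q.1.2, fun o =>
    match h : m o with
    | none => q.2 ⟨o, h⟩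
    | some i => (q.1.1 i).2 ⟨o, h⟩)
  left_inv p := by
    refine Prod.ext rfl (Prod.ext rfl (funext fun o => ?_))
    dsimp only
    split <;> rfl
  right_inv q := by
    refine Prod.ext (Prod.ext (funext fun i => Prod.ext rfl (funext fun o => ?_)) rfl)
      (funext fun o => ?_)
    · obtain ⟨o, ho⟩ := o
      dsimp only
      split
      · rename_i hj
        exact absurd (hj.symm.trans ho) (by simp)
      · rename_i j hj
        obtain rfl : j = i := by simpa [hj] using ho
        rfl
    · obtain ⟨o, ho⟩ := o
      dsimp only
      split
      · rfl
      · rename_i j hj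
        exact absurd (hj.symm.trans ho) (by simp)

/-- One branch of a standard decoupling: apply the other channel `N' : A' → B' E'` to
`φ_{V₁…Vₙ A A'}`, add its outputs to the auxiliary systems as `m` prescribes, and trace out the
unassigned ones. -/
def decouple (m : Output → Option (Fin n)) (N' : Channel A' O)
    (φ : State ((∀ i, V i) × (A × A'))) : State ((∀ i, NewAux m V O i) × A) :=
  ((φ.conj ((1 : Matrix (∀ i, V i) (∀ i, V i) ℂ) ⊗ₖ ((1 : Matrix A A ℂ) ⊗ₖ N'.U))
    (one_kronecker_isometry (one_kronecker_isometry N'.isometry))).relabel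
      (regroupEquiv m V A O)).partialTrace

end Decoupling

/-- `f_α` is uniformly subadditive with respect to the standard decoupling `D`: for all channels
and all states `φ_{V₁…Vₙ A₁ A₂}`, with decoupled states `φ̃` and `φ̂`,
`f_α(U₁ ⊗ U₂, φ) ≤ f_α(U₁, φ̃) + f_α(U₂, φ̂)`. -/
def UniformlySubadditive {n : ℕ} (α : Finset Output → Finset (Fin n) → ℝ)
    (D : StandardDecoupling n) : Prop :=
  ∀ (A₁ A₂ : Type) [Fintype A₁] [DecidableEq A₁] [Fintype A₂] [DecidableEq A₂]
    (O₁ O₂ : Output → Type) [∀ o, Fintype (O₁ o)] [∀ o, DecidableEq (O₁ o)]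
    [∀ o, Fintype (O₂ o)] [∀ o, DecidableEq (O₂ o)]
    (N₁ : Channel A₁ O₁) (N₂ : Channel A₂ O₂)
    (V : Fin n → Type) [∀ i, Fintype (V i)] [∀ i, DecidableEq (V i)]
    (φ : State ((∀ i, V i) × (A₁ × A₂))),
    formula α (N₁.tensor N₂) φ ≤
      formula α N₁ (decouple D.tilde N₂ φ) +
        formula α N₂ (decouple D.hat N₁
          (φ.relabel (Equiv.prodCongr (Equiv.refl _) (Equiv.prodComm A₁ A₂))))

/-- The coefficient sum `η_t = ∑_{s ⊆ {B,E}} α_{s,t}`. -/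
def coeffSum {n : ℕ} (α : Finset Output → Finset (Fin n) → ℝ) (t : Finset (Fin n)) : ℝ :=
  ∑ s : Finset Output, α s t

end EntropicFormula

end

/-! Test states: let the `V i` with `i ∈ J` carry one uniformly random value of `X`, perfectly
correlated, let the others be constant, and tensor with a fixed input state. Then `H(st)` is the
output entropy on `s`, plus `log |X|` exactly when `t` meets `J`; so the formula equals `log |X| *
meetSum α J` plus a constant independent of `X`. Finiteness of the supremum, as `|X|` grows, forces
`meetSum α J ≤ 0` (`meetSum_nonpos`). Subadditivity for two trivial channels reads `f ≤ f + f` on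
these states, hence `meetSum α J ≥ 0` (`meetSum_nonneg`). All `meetSum α J` therefore vanish, and
inclusion-exclusion over subsets recovers each `η_t` (`coeffSum_eq_zero_of_meetSum`). -/

namespace EntropicFormula

/-! ### Entropy of product states and of uniform classical mixtures. -/

namespace State

variable {Ω Ω' K R X : Type} [Fintype Ω] [Fintype Ω'] [Fintype K] [Fintype R] [Fintype X]

/-- The entropy can be computed from any unitary diagonalization. -/
theorem entropy_eq_of_mat_eq [DecidableEq Ω] (ρ : State Ω) (W : Matrix Ω Ω ℂ) (hW : Wᴴ * W = 1)
    (d : Ω → ℝ) (h : ρ.mat = W * Matrix.diagonal (fun i => (d i : ℂ)) * Wᴴ) :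
    ρ.entropy = ∑ i, Real.negMulLog (d i) := by
  -- Eigenvalues come in an unspecified order, so they are compared with `d` as the multiset of
  -- roots of the characteristic polynomial.
  have hc : ρ.mat.charpoly = (Matrix.diagonal (fun i => (d i : ℂ))).charpoly := by
    rw [h, Matrix.charpoly_mul_comm, ← Matrix.mul_assoc, hW, Matrix.one_mul]
  have hr : ρ.mat.charpoly.roots = Finset.univ.val.map (fun i => (d i : ℂ)) := by
    rw [hc, Matrix.charpoly_diagonal, Polynomial.roots_prod _ _ (by
      simp [Finset.prod_ne_zero_iff, Polynomial.X_sub_C_ne_zero])]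
    simp
  rw [ρ.posSemidef.isHermitian.roots_charpoly_eq_eigenvalues] at hr
  have hs := congrArg (fun m => (m.map (fun z : ℂ => Real.negMulLog z.re)).sum) hr
  simpa [entropy, Multiset.map_map, Function.comp_def] using hs

theorem entropy_eq_of_mat_eq_diagonal [DecidableEq Ω] (ρ : State Ω) (d : Ω → ℝ)
    (h : ρ.mat = Matrix.diagonal (fun i => (d i : ℂ))) :
    ρ.entropy = ∑ i, Real.negMulLog (d i) :=
  ρ.entropy_eq_of_mat_eq 1 (by simp) d (by simp [h])

theorem mat_apply_of_subsingleton [Subsingleton Ω] (ρ : State Ω) (a b : Ω) : ρ.mat a b = 1 := by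
  rw [Subsingleton.elim b a, ← ρ.trace_eq_one, Matrix.trace,
    Finset.sum_eq_single a (fun c _ hc => (hc (Subsingleton.elim c a)).elim) (by simp)]
  rfl

theorem entropy_of_subsingleton [DecidableEq Ω] [Subsingleton Ω] (ρ : State Ω) :
    ρ.entropy = 0 := by
  rw [ρ.entropy_eq_of_mat_eq_diagonal (fun _ => 1)]
  · simp
  · ext a b
    rw [mat_apply_of_subsingleton, Subsingleton.elim b a]
    simp

theorem exists_eq_conj_diagonal [DecidableEq Ω] (ρ : State Ω) :
    ∃ (W : Matrix Ω Ω ℂ) (d : Ω → ℝ), Wᴴ * W = 1 ∧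
      ρ.mat = W * Matrix.diagonal (fun i => (d i : ℂ)) * Wᴴ := by
  have hρ := ρ.posSemidef.isHermitian
  refine ⟨hρ.eigenvectorUnitary, hρ.eigenvalues, ?_, ?_⟩
  · exact Unitary.coe_star_mul_self hρ.eigenvectorUnitary
  · conv_lhs => rw [hρ.spectral_theorem, Unitary.conjStarAlgAut_apply]
    rfl

theorem sum_diagonal_eq_one [DecidableEq Ω] {ρ : State Ω} {W : Matrix Ω Ω ℂ} {d : Ω → ℝ}
    (hW : Wᴴ * W = 1) (h : ρ.mat = W * Matrix.diagonal (fun i => (d i : ℂ)) * Wᴴ) :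
    ∑ i, d i = 1 := by
  have ht := ρ.trace_eq_one
  rw [h, Matrix.trace_mul_comm, ← Matrix.mul_assoc, hW, Matrix.one_mul,
    Matrix.trace_diagonal] at ht
  exact_mod_cast ht

/-- The product state `ρ ⊗ σ`. -/
def prod (ρ : State Ω) (σ : State Ω') : State (Ω × Ω') where
  mat := ρ.mat ⊗ₖ σ.mat
  posSemidef := ρ.posSemidef.kronecker σ.posSemidef
  trace_eq_one := by rw [Matrix.trace_kronecker, ρ.trace_eq_one, σ.trace_eq_one, one_mul]

/-- The entropy is additive on product states. -/
theorem entropy_prod [DecidableEq Ω] [DecidableEq Ω'] (ρ : State Ω) (σ : State Ω') :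
    (ρ.prod σ).entropy = ρ.entropy + σ.entropy := by
  obtain ⟨W, d, hW, hd⟩ := ρ.exists_eq_conj_diagonal
  obtain ⟨W', d', hW', hd'⟩ := σ.exists_eq_conj_diagonal
  rw [(ρ.prod σ).entropy_eq_of_mat_eq (W ⊗ₖ W') _ (fun p => d p.1 * d' p.2),
    ρ.entropy_eq_of_mat_eq W hW d hd, σ.entropy_eq_of_mat_eq W' hW' d' hd']
  -- Since `negMulLog (x * y) = y * negMulLog x + x * negMulLog y`, additivity only needs both
  -- spectra to sum to one.
  · have h1 := sum_diagonal_eq_one hW hd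
    have h1' := sum_diagonal_eq_one hW' hd'
    simp only [Real.negMulLog_mul, Fintype.sum_prod_type, Finset.sum_add_distrib,
      ← Finset.sum_mul, ← Finset.mul_sum, h1, h1', one_mul]
  · have hD : Matrix.diagonal (fun p : Ω × Ω' => ((d p.1 * d' p.2 : ℝ) : ℂ)) =
        Matrix.diagonal (fun i => (d i : ℂ)) ⊗ₖ Matrix.diagonal (fun i => (d' i : ℂ)) := by
      rw [Matrix.diagonal_kronecker_diagonal]
      simp
    rw [hD, Matrix.conjTranspose_kronecker, ← Matrix.mul_kronecker_mul,
      ← Matrix.mul_kronecker_mul, ← hd, ← hd']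
    rfl
  · rw [Matrix.conjTranspose_kronecker, ← Matrix.mul_kronecker_mul, hW, hW',
      Matrix.one_kronecker_one]

theorem conj_prod [DecidableEq Ω] [DecidableEq Ω'] {U : Matrix K Ω' ℂ} (hU : Uᴴ * U = 1)
    (ρ : State Ω) (σ : State Ω') :
    (ρ.prod σ).conj ((1 : Matrix Ω Ω ℂ) ⊗ₖ U) (one_kronecker_isometry hU) =
      ρ.prod (σ.conj U hU) := by
  ext1
  simp only [conj, prod]
  rw [Matrix.conjTranspose_kronecker, ← Matrix.mul_kronecker_mul, ← Matrix.mul_kronecker_mul]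
  simp

/-- The uniform mixture of the basis states `g x`. -/
noncomputable def empirical [DecidableEq Ω] [Nonempty X] (g : X → Ω) : State Ω where
  mat := Matrix.diagonal fun v =>
    ((∑ x, if g x = v then (Fintype.card X : ℝ)⁻¹ else 0 : ℝ) : ℂ)
  posSemidef := Matrix.PosSemidef.diagonal fun v => by
    rw [Pi.zero_apply, Complex.zero_le_real]
    positivity
  trace_eq_one := by
    rw [Matrix.trace_diagonal, ← Complex.ofReal_sum, Finset.sum_comm]
    simp

theorem empirical_apply [DecidableEq Ω] [Nonempty X] (g : X → Ω) (v w : Ω) :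
    (empirical g).mat v w =
      ∑ x, if g x = v ∧ g x = w then (Fintype.card X : ℂ)⁻¹ else 0 := by
  simp only [empirical, Matrix.diagonal_apply]
  split_ifs with h
  · subst h
    rw [Complex.ofReal_sum]
    refine Finset.sum_congr rfl fun x _ => ?_
    split_ifs <;> simp_all
  · refine (Finset.sum_eq_zero fun x _ => if_neg ?_).symm
    rintro ⟨rfl, h'⟩
    exact h h'

/-- Injectivity makes the spectrum `1 / |X|` on the image of `g` and zero elsewhere. -/
theorem entropy_empirical_of_injective [DecidableEq Ω] [Nonempty X] {g : X → Ω}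
    (hg : Function.Injective g) : (empirical g).entropy = Real.log (Fintype.card X) := by
  rw [entropy_eq_of_mat_eq_diagonal _ _ rfl]
  have h0 : (Fintype.card X : ℝ) ≠ 0 := by positivity
  calc _ = ∑ v ∈ Finset.univ.image g, Real.negMulLog (Fintype.card X : ℝ)⁻¹ := by
        refine (Finset.sum_subset (Finset.subset_univ (Finset.univ.image g)) ?_).symm.trans ?_
        rotate_left
        · refine Finset.sum_congr rfl fun v hv => ?_
          obtain ⟨y, -, rfl⟩ := Finset.mem_image.1 hv
          rw [Finset.sum_eq_single y (fun x _ hx => if_neg (hg.ne hx)) (by simp), if_pos rfl]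
        · intro v _ hv
          rw [Finset.sum_eq_zero, Real.negMulLog_zero]
          exact fun x _ => if_neg fun h =>
            hv (Finset.mem_image.2 ⟨x, Finset.mem_univ x, h⟩)
    _ = Real.log (Fintype.card X) := by
        rw [Finset.sum_const, Finset.card_image_of_injective _ hg, Finset.card_univ,
          Real.negMulLog, Real.log_inv, nsmul_eq_mul]
        field_simp

theorem entropy_empirical_of_const [DecidableEq Ω] [Nonempty X] {g : X → Ω}
    (hg : ∀ x y, g x = g y) : (empirical g).entropy = 0 := by
  rw [entropy_eq_of_mat_eq_diagonal _ _ rfl]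
  refine Finset.sum_eq_zero fun v _ => ?_
  by_cases h : ∃ y, g y = v
  · obtain ⟨y, rfl⟩ := h
    simp [hg _ y]
  · simp only [not_exists] at h
    simp [h]

end State

/-! ### The formula on correlated test states. -/

section Evaluation

variable {n : ℕ} {V : Fin n → Type} [∀ i, Fintype (V i)] [∀ i, DecidableEq (V i)]
  {A A' : Type} [Fintype A] [DecidableEq A] [Fintype A'] [DecidableEq A']
  {O : Output → Type} [∀ o, Fintype (O o)]
  {X : Type} [Fintype X] [Nonempty X]

/-- The reduced state on the outputs in `s` when the channel input is `ψ`. -/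
noncomputable def reducedOutput (N : Channel A O) (ψ : State A) (s : Finset Output) :
    State (∀ o : {o // o ∈ s}, O o) :=
  ((ψ.conj N.U N.isometry).relabel (Equiv.piEquivPiSubtypeProd (· ∈ s) O)).partialTrace

/-- The channel acts only on the factor `ψ`, and tracing out coordinates of a classical mixture
restricts `g` to the remaining ones. -/
theorem partialTrace_outputState_empirical_prod (N : Channel A O) (g : X → ∀ i, V i)
    (ψ : State A) (s : Finset Output) (t : Finset (Fin n)) :
    ((outputState N ((State.empirical g).prod ψ)).relabel (splitEquiv s t)).partialTrace =
      (State.empirical fun x (i : {i // i ∈ t}) => g x i).prod (reducedOutput N ψ s) := by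
  rw [outputState, State.conj_prod N.isometry]
  ext ⟨a, b⟩ ⟨a', b'⟩
  have key : ∀ c, (State.empirical g).mat ((Equiv.piEquivPiSubtypeProd (· ∈ t) V).symm (a, c))
      ((Equiv.piEquivPiSubtypeProd (· ∈ t) V).symm (a', c)) =
      ∑ x, if (fun i : {i // i ∉ t} => g x i) = c then
        (if (fun i : {i // i ∈ t} => g x i) = a ∧ (fun i : {i // i ∈ t} => g x i) = a' then
          (Fintype.card X : ℂ)⁻¹ else 0) else 0 := by
    intro c
    rw [State.empirical_apply]
    refine Finset.sum_congr rfl fun x _ => ?_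
    simp only [Equiv.eq_symm_apply, Equiv.piEquivPiSubtypeProd_apply, Prod.mk.injEq]
    rw [← ite_and]
    exact if_congr (by tauto) rfl rfl
  have h : (State.empirical fun x (i : {i // i ∈ t}) => g x i).mat a a' =
      ∑ c, (State.empirical g).mat ((Equiv.piEquivPiSubtypeProd (· ∈ t) V).symm (a, c))
      ((Equiv.piEquivPiSubtypeProd (· ∈ t) V).symm (a', c)) := by
    simp_rw [key]
    rw [Finset.sum_comm, State.empirical_apply]
    simp
  have hr : ((State.empirical fun x (i : {i // i ∈ t}) => g x i).prod
      (reducedOutput N ψ s)).mat (a, b) (a', b') =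
      (State.empirical fun x (i : {i // i ∈ t}) => g x i).mat a a' *
        (reducedOutput N ψ s).mat b b' := rfl
  rw [hr, h]
  simp only [State.partialTrace, State.relabel, Matrix.of_apply, Fintype.sum_prod_type,
    reducedOutput, Finset.sum_mul_sum]
  rfl

variable [∀ o, DecidableEq (O o)]

/-- A single coordinate in `t ∩ J` already determines `x`, giving entropy `log |X|`; if there is
none, the restricted mixture is a pure basis state. -/
theorem entropyOf_empirical_prod (N : Channel A O) {g : X → ∀ i, V i} {J : Finset (Fin n)}
    (hJ : ∀ i ∈ J, Function.Injective fun x => g x i) (hJ' : ∀ i ∉ J, ∀ x y, g x i = g y i)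
    (ψ : State A) (s : Finset Output) (t : Finset (Fin n)) :
    entropyOf (outputState N ((State.empirical g).prod ψ)) s t =
      (if Disjoint t J then 0 else Real.log (Fintype.card X)) + (reducedOutput N ψ s).entropy := by
  rw [entropyOf, partialTrace_outputState_empirical_prod, State.entropy_prod]
  congr 1
  split_ifs with h
  · refine State.entropy_empirical_of_const fun x y => funext fun i => ?_
    exact hJ' i (Finset.disjoint_left.1 h i.2) x y
  · obtain ⟨i, hi, hi'⟩ := Finset.not_disjoint_iff.1 h
    refine State.entropy_empirical_of_injective fun x y hxy => hJ i hi' ?_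
    exact congrFun hxy ⟨i, hi⟩

/-- The sum of the coefficients `η_t` over the collections `t` that meet `J`. -/
noncomputable def meetSum (α : Finset Output → Finset (Fin n) → ℝ) (J : Finset (Fin n)) : ℝ :=
  ∑ t : Finset (Fin n), if Disjoint t J then 0 else coeffSum α t

theorem formula_empirical_prod (α : Finset Output → Finset (Fin n) → ℝ) (N : Channel A O)
    {g : X → ∀ i, V i} {J : Finset (Fin n)}
    (hJ : ∀ i ∈ J, Function.Injective fun x => g x i) (hJ' : ∀ i ∉ J, ∀ x y, g x i = g y i)
    (ψ : State A) :
    formula α N ((State.empirical g).prod ψ) =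
      Real.log (Fintype.card X) * meetSum α J +
        ∑ s : Finset Output, ∑ t : Finset (Fin n), α s t * (reducedOutput N ψ s).entropy := by
  simp only [formula, entropyOf_empirical_prod N hJ hJ', mul_add, Finset.sum_add_distrib,
    meetSum, coeffSum]
  congr 1
  rw [Finset.sum_comm, Finset.mul_sum]
  refine Finset.sum_congr rfl fun t _ => ?_
  split_ifs
  · simp
  · rw [← Finset.sum_mul, mul_comm]

theorem formula_empirical_prod_of_subsingleton [∀ o, Subsingleton (O o)]
    (α : Finset Output → Finset (Fin n) → ℝ) (N : Channel A O)
    {g : X → ∀ i, V i} {J : Finset (Fin n)}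
    (hJ : ∀ i ∈ J, Function.Injective fun x => g x i) (hJ' : ∀ i ∉ J, ∀ x y, g x i = g y i)
    (ψ : State A) :
    formula α N ((State.empirical g).prod ψ) = Real.log (Fintype.card X) * meetSum α J := by
  simp [formula_empirical_prod α N hJ hJ', State.entropy_of_subsingleton]

/-- Decoupling with respect to a channel with trivial outputs only adds trivial systems. -/
theorem decouple_empirical_prod [Subsingleton A] [∀ o, Subsingleton (O o)]
    (m : Output → Option (Fin n)) (N' : Channel A' O) (g : X → ∀ i, V i) (y : ∀ o, O o)
    (ψ : State (A × A')) (ψ' : State A) :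
    decouple m N' ((State.empirical g).prod ψ) =
      (State.empirical fun x i => ((g x i, fun o => y o.1) : NewAux m V O i)).prod ψ' := by
  rw [decouple, State.conj_prod (one_kronecker_isometry N'.isometry)]
  ext ⟨v, a⟩ ⟨v', a'⟩
  have hv : ∀ (w : ∀ i, NewAux m V O i) x,
      ((fun i => ((g x i, fun o => y o.1) : NewAux m V O i)) = w) ↔ g x = fun i => (w i).1 := by
    intro w x
    constructor
    · rintro rfl
      rfl
    · intro h
      funext i
      exact Prod.ext (congrFun h i) (Subsingleton.elim _ _)
  have hr : ((State.empirical fun x i => ((g x i, fun o => y o.1) : NewAux m V O i)).prod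
      ψ').mat (v, a) (v', a') =
      (State.empirical fun x i => ((g x i, fun o => y o.1) : NewAux m V O i)).mat v v' *
        ψ'.mat a a' := rfl
  -- A one-dimensional system has only one state, so `ψ'` may be arbitrary.
  rw [hr, State.mat_apply_of_subsingleton ψ', mul_one, State.empirical_apply]
  simp only [hv]
  rw [← State.empirical_apply]
  simp only [State.partialTrace, State.relabel, Matrix.of_apply]
  rw [Fintype.sum_subsingleton _ (fun o => y o.1 : ∀ o : {o // m o = none}, O o)]
  simp only [Matrix.submatrix_apply, State.prod, Matrix.kroneckerMap_apply,
    State.mat_apply_of_subsingleton (State.conj _ _ ψ), mul_one]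
  rfl

end Evaluation

/-! ### The two sign bounds and the inversion. -/

variable {n : ℕ} {α : Finset Output → Finset (Fin n) → ℝ}

/-- The channel all of whose systems are one-dimensional. -/
def Channel.trivial : Channel Unit (fun _ => Unit) where
  U := Matrix.of fun _ _ => 1
  isometry := by
    ext a b
    simp [Matrix.mul_apply]

/-- The basis vectors in which the systems in `J` are perfectly correlated and the others are
constant. -/
def correlated (X : Type) [Inhabited X] (J : Finset (Fin n)) (x : X) (i : Fin n) : X :=
  if i ∈ J then x else default

theorem correlated_injective {X : Type} [Inhabited X] {J : Finset (Fin n)} {i : Fin n}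
    (hi : i ∈ J) : Function.Injective fun x : X => correlated X J x i := by
  intro x y h
  simpa [correlated, hi] using h

theorem correlated_const {X : Type} [Inhabited X] {J : Finset (Fin n)} {i : Fin n}
    (hi : i ∉ J) (x y : X) : correlated X J x i = correlated X J y i := by
  simp [correlated, hi]

/-- With trivial channels, decoupling by any `D` leaves the correlations unchanged, so subadditivity
gives `f ≤ 2 f` with `f = log 2 * meetSum α J`. -/
theorem meetSum_nonneg {D : StandardDecoupling n} (hsub : UniformlySubadditive α D)
    (J : Finset (Fin n)) : 0 ≤ meetSum α J := by
  have hJ := fun i (hi : i ∈ J) => correlated_injective (X := Bool) hi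
  have hJ' := fun i (hi : i ∉ J) => correlated_const (X := Bool) hi
  let u : State Unit := State.empirical (id : Unit → Unit)
  have h := hsub Unit Unit _ _ Channel.trivial Channel.trivial (fun _ => Bool)
    ((State.empirical (correlated Bool J)).prod (u.prod u))
  have hrel : ((State.empirical (correlated Bool J)).prod (u.prod u)).relabel
      (Equiv.prodCongr (Equiv.refl _) (Equiv.prodComm Unit Unit)) =
      (State.empirical (correlated Bool J)).prod
        ((u.prod u).relabel (Equiv.prodComm Unit Unit)) := rfl
  rw [hrel, decouple_empirical_prod _ _ _ (fun _ => ()) _ u,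
    decouple_empirical_prod _ _ _ (fun _ => ()) _ u,
    formula_empirical_prod_of_subsingleton α _ hJ hJ',
    formula_empirical_prod_of_subsingleton α _ (J := J)
      (fun i hi x y hxy => hJ i hi (Prod.ext_iff.1 hxy).1)
      (fun i hi x y => Prod.ext (hJ' i hi x y) rfl),
    formula_empirical_prod_of_subsingleton α _ (J := J)
      (fun i hi x y hxy => hJ i hi (Prod.ext_iff.1 hxy).1)
      (fun i hi x y => Prod.ext (hJ' i hi x y) rfl)] at h
  have h2 : 0 < Real.log (Fintype.card Bool) := Real.log_pos (by simp)
  nlinarith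

/-- A positive `meetSum α J` would make the formula grow without bound as the correlated alphabet
grows. -/
theorem meetSum_nonpos {A : Type} [Fintype A] [DecidableEq A] [Nonempty A]
    {O : Output → Type} [∀ o, Fintype (O o)] [∀ o, DecidableEq (O o)] {N : Channel A O}
    (hN : maxFormula α N < ⊤) (J : Finset (Fin n)) : meetSum α J ≤ 0 := by
  obtain ⟨C, hC⟩ : ∃ C : ℝ, maxFormula α N ≤ C := by
    obtain ⟨C, hC, -⟩ := EReal.lt_iff_exists_real_btwn.1 hN
    exact ⟨C, hC.le⟩
  let ψ : State A := State.empirical (id : A → A)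
  let c : ℝ := ∑ s : Finset Output, ∑ t : Finset (Fin n), α s t * (reducedOutput N ψ s).entropy
  -- The alphabet is `Fin (d + 1)`, which is never empty.
  have hle : ∀ d : ℕ, Real.log (d + 1 : ℕ) * meetSum α J + c ≤ C := by
    intro d
    have hf := formula_empirical_prod α N (X := Fin (d + 1))
      (fun i (hi : i ∈ J) => correlated_injective hi) (fun i hi => correlated_const hi) ψ
    rw [Fintype.card_fin] at hf
    rw [← hf, ← EReal.coe_le_coe_iff]
    refine le_trans ?_ hC
    exact le_iSup_of_le (fun _ => Fin (d + 1)) <| le_iSup_of_le inferInstance <|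
      le_iSup_of_le inferInstance <| le_iSup_of_le _ le_rfl
  by_contra! hpos
  have hlim : Filter.Tendsto (fun d : ℕ => Real.log (d + 1 : ℕ) * meetSum α J)
      Filter.atTop Filter.atTop :=
    ((Real.tendsto_log_atTop.comp tendsto_natCast_atTop_atTop).comp
      (Filter.tendsto_add_atTop_nat 1)).atTop_mul_const hpos
  obtain ⟨d, hd⟩ := (hlim.eventually_gt_atTop (C - c)).exists
  linarith [hle d]

/-- The numbers `meetSum α J` determine the coefficient sums of the non-empty collections. -/
theorem coeffSum_eq_zero_of_meetSum (h : ∀ J, meetSum α J = 0) (t : Finset (Fin n))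
    (ht : t.Nonempty) : coeffSum α t = 0 := by
  have hsub : ∀ K : Finset (Fin n),
      ∑ u : Finset (Fin n), (if u.Nonempty ∧ u ⊆ K then coeffSum α u else 0) = 0 := by
    intro K
    -- Meeting `univ` means being non-empty, and missing `Kᶜ` means lying in `K`; the difference
    -- keeps exactly the non-empty subsets of `K`.
    have h0 : meetSum α Finset.univ - meetSum α Kᶜ = 0 := by rw [h, h, sub_zero]
    refine Eq.trans ?_ h0
    rw [meetSum, meetSum, ← Finset.sum_sub_distrib]
    refine Finset.sum_congr rfl fun u _ => ?_
    rcases u.eq_empty_or_nonempty with rfl | hu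
    · simp
    · have hu' : ¬ Disjoint u Finset.univ := by
        simpa [← Finset.top_eq_univ, disjoint_top] using hu.ne_empty
      by_cases hK : u ⊆ K <;> simp [hu, hu', hK, disjoint_compl_right_iff]
  induction t using Finset.strongInduction with
  | H t ih =>
    rw [← hsub t, Finset.sum_eq_single t]
    · simp [ht]
    · intro u _ hu
      split_ifs with hc
      · exact ih u (hc.2.ssubset_of_ne hu) hc.1
      · rfl
    · simp

end EntropicFormula

theorem mainTheorem10 (n : ℕ)
    (α : Finset EntropicFormula.Output → Finset (Fin n) → ℝ)
    (hfin : ∃ (A : Type) (_ : Fintype A) (_ : DecidableEq A) (_ : Nonempty A)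
      (O : EntropicFormula.Output → Type) (_ : ∀ o, Fintype (O o)) (_ : ∀ o, DecidableEq (O o))
      (N : EntropicFormula.Channel A O), EntropicFormula.maxFormula α N < ⊤)
    (D : EntropicFormula.StandardDecoupling n)
    (hsub : EntropicFormula.UniformlySubadditive α D)
    (t : Finset (Fin n)) (ht : t.Nonempty) :
    EntropicFormula.coeffSum α t = 0 := by
  obtain ⟨A, _, _, _, O, _, _, N, hN⟩ := hfin
  exact EntropicFormula.coeffSum_eq_zero_of_meetSum (fun J => le_antisymm
    (EntropicFormula.meetSum_nonpos hN J) (EntropicFormula.meetSum_nonneg hsub J)) t ht
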